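/- Setting. Let $H$ be a separable complex Hilbert space and $M\subset B(H)$ a von Neumann algebra. Its predual $M_*$ is the space of ultraweakly (that is, weak*-) continuous linear functionals on $M$; we write $[l,X]=l(X)$ for $l\in M_*$, $X\in M$. Assume that $M$ is finite, and let $\tau$ be a faithful normal trace on $M$: an ultraweakly continuous linear functional with $\tau(AB)=\tau(BA)$ for all $A,B\in M$ such that, for every positive $A\in M$, $\tau(A)\ge 0$, and $\tau(A)=0$ only if $A=0$. Let $B(M)$ be the algebra of bounded linear operators on $M$ and $B_w(M)$ the subalgebra of weak*-continuous ones; for $\phi\in B_w(M)$ let $\phi_*$ be the operator on $M_*$ with $[\phi_*l,X]=[l,\phi(X)]$. For $X\in M$ let $\Psi_\tau(X)=l_X\in M_*$, $l_X(Y)=\tau(XY)$; the map $\Psi_\tau:M\to M_*$ is injective. A map $\phi\in B_w(M)$ is called $\tau$-$M$-stable, written $\phi\in\widehat B_\tau(M)$, if $\phi_*(\operatorname{ran}\Psi_\tau)\subset\operatorname{ran}\Psi_\tau$; its $\tau$-dual is then $\widehat\phi_\tau=\Psi_\tau^{-1}\phi_*\Psi_\tau\in B(M)$. A Banach limit is a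 linear functional $L$ on the space $\ell^\infty$ of bounded complex sequences $(u_n)_{n\ge1}$ with $\|L\|=L(\mathbf 1)=1$ and $L((u_{n+1})_n)=L((u_n)_n)$. A bounded sequence $(u_n)_{n\ge1}$ almost converges to $c\in\mathbb C$ if $\sup_{k}\bigl|\frac1{n+1}\sum_{i=k}^{k+n}u_i-c\bigr|\to0$ as $n\to\infty$, and strongly almost converges to $c$ if $(|u_n-c|)_n$ almost converges to $0$. A sequence $(\phi_n)_{n\ge1}$ in $B_w(M)$ weakly almost converges to $\phi\in B_w(M)$ if $([l,\phi_n(X)-\phi(X)])_n$ almost converges to $0$ for all $l\in M_*$, $X\in M$. A gauge is a map $p:\{1,2,\dots\}\to(0,\infty)$ such that $p(n+1)/p(n)$ strongly almost converges to some number $c_p>0$. A sequence $(T_n)_{n\ge1}$ of operators is dominated by $p$ if $\|T_n\|\le p(n)$ for all $n\ge1$. For a sequence $\Phi=(\phi_n)_{n\ge1}$ in $B(M)$ dominated by $p$ and a Banach limit $L$, let $E_{\Phi,L}\in B(M)$ be the operator determined by $$[l,E_{\Phi,L}(X)]=L\bigl(([l,\phi_n(X)]\,p(n)^{-1})_{n\ge1}\bigr)\qquad(l\in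 M_*,\ X\in M).$$ Put $\gamma_L(p)=L\bigl((c_p^n/p(n))_{n\ge1}\bigr)$ if the sequence $c_p^n/p(n)$ is bounded, and $\gamma_L(p)=0$ otherwise. **Theorem.** Let $M$ and $\tau$ be as above and let $p$ be a gauge. Let $\Phi=(\phi_n)_{n\ge1}$ be a sequence in $\widehat B_\tau(M)$ such that $\Phi$ and $\widehat\Phi_\tau=((\widehat{\phi_n})_\tau)_{n\ge1}$ are both dominated by $p$. (i) For every Banach limit $L$, the operator $E_{\Phi,L}$ belongs to $\widehat B_\tau(M)$, and $(\widehat{E_{\Phi,L}})_\tau=E_{\widehat\Phi_\tau,L}$. (ii) If $\Phi$ is abelian, that is, $\phi_m\phi_n=\phi_n\phi_m$ for all $m,n$, then $E_{\Phi,L_1}$ and $E_{\Phi,L_2}$ commute for all Banach limits $L_1,L_2$. (iii) Let $\psi\in\widehat B_\tau(M)$ be such that the sequences $\Phi=(\psi^n)_{n\ge1}$ and $((\widehat\psi_\tau)^n)_{n\ge1}$ are both dominated by $p$. Then for all Banach limits $L_1,L_2$ $$E_{\Phi,L_2}\circ E_{\Phi,L_1}=E_{\Phi,L_1}\circ E_{\Phi,L_2}=\gamma_{L_1}(p)E_{\Phi,L_2}=\gamma_{L_2}(p)E_{\Phi,L_1}.$$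 If the sequence $c_p^n/p(n)$ is unbounded, then $E_{\Phi,L}=0$ for every Banach limit $L$ (so that the value given to $\gamma_L(p)$ in this case is immaterial). If $c_p^n/p(n)$ almost converges to a nonzero limit, then $(p(n)^{-1}\psi^n)_{n\ge1}$ weakly almost converges to an operator $\phi\in\widehat B_\tau(M)$. -/

import Mathlib

open Filter Topology
open scoped BoundedContinuousFunction InnerProductSpace

noncomputable section

namespace FiniteVN

universe u

variable {H : Type u} [NormedAddCommGroup H] [InnerProductSpace ℂ H] [CompleteSpace H]

/-! ### The ultraweak topology and the predual of a von Neumann algebra -/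

/-- The elements of a von Neumann algebra `M`, as a type carrying the operator norm and the
C⋆-algebra operations inherited from `B(H)`. -/
abbrev Elem (M : VonNeumannAlgebra H) : Type u := ↥M.toStarSubalgebra

/-- Square-summable sequences of vectors of `H`. -/
abbrev SqSummable (H : Type u) [NormedAddCommGroup H] : Type u :=
  {x : ℕ → H // Summable fun n => ‖x n‖ ^ 2}

/-- The pairing of an operator `A` with the trace class operator `∑ xₙ ⊗ yₙ`, that is
`∑ ⟨A xₙ, yₙ⟩` (Mathlib's inner product is conjugate-linear in its first variable). -/
def ultraweakPairing (x y : SqSummable H) (A : H →L[ℂ] H) : ℂ :=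
  ∑' n, ⟪y.1 n, A (x.1 n)⟫_ℂ

/-- The ultraweak (weak-star) topology on `M`: the coarsest topology for which all the functionals
`A ↦ ∑ ⟨A xₙ, yₙ⟩` with `∑ ‖xₙ‖² < ∞`, `∑ ‖yₙ‖² < ∞` are continuous. -/
@[reducible]
def ultraweak (M : VonNeumannAlgebra H) : TopologicalSpace (Elem M) :=
  ⨅ q : SqSummable H × SqSummable H,
    TopologicalSpace.induced (fun A : Elem M => ultraweakPairing q.1 q.2 (A : H →L[ℂ] H))
      inferInstance

/-- The predual `M_*` of `M`: the ultraweakly continuous linear functionals on `M`, with the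
norm of the dual of `M`. -/
def Predual (M : VonNeumannAlgebra H) : Submodule ℂ (StrongDual ℂ (Elem M)) where
  carrier := {l | Continuous[ultraweak M, inferInstance] l}
  add_mem' {a b} ha hb := by
    let _ := ultraweak M
    exact Continuous.add (f := a) (g := b) ha hb
  zero_mem' := by
    let _ := ultraweak M
    exact continuous_const (y := (0 : ℂ))
  smul_mem' c l hl := by
    let _ := ultraweak M
    exact Continuous.const_smul (g := l) hl c

theorem summable_pairing (x y : SqSummable H) (A : H →L[ℂ] H) :
    Summable fun n => ⟪y.1 n, A (x.1 n)⟫_ℂ := by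
  refine Summable.of_norm_bounded
    (g := fun n => ‖A‖ * (‖x.1 n‖ ^ 2 + ‖y.1 n‖ ^ 2)) ((x.2.add y.2).mul_left _) fun n => ?_
  calc ‖⟪y.1 n, A (x.1 n)⟫_ℂ‖ ≤ ‖y.1 n‖ * ‖A (x.1 n)‖ := norm_inner_le_norm _ _
    _ ≤ ‖y.1 n‖ * (‖A‖ * ‖x.1 n‖) := by gcongr; exact A.le_opNorm _
    _ = ‖A‖ * (‖x.1 n‖ * ‖y.1 n‖) := by ring
    _ ≤ _ := by
      gcongr
      nlinarith [sq_nonneg (‖x.1 n‖ - ‖y.1 n‖), sq_nonneg ‖x.1 n‖, sq_nonneg ‖y.1 n‖]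

theorem continuous_pairing (M : VonNeumannAlgebra H) (x y : SqSummable H) :
    Continuous[ultraweak M, inferInstance]
      (fun A : Elem M => ultraweakPairing x y (A : H →L[ℂ] H)) := by
  rw [continuous_iff_le_induced]
  exact iInf_le (fun q : SqSummable H × SqSummable H =>
    TopologicalSpace.induced (fun A : Elem M => ultraweakPairing q.1 q.2 (A : H →L[ℂ] H))
      inferInstance) (x, y)

/-- A bounded operator `A` applied to a square-summable sequence. -/
def SqSummable.map (A : H →L[ℂ] H) (x : SqSummable H) : SqSummable H :=
  ⟨fun n => A (x.1 n), by
    refine Summable.of_nonneg_of_le (fun _ => by positivity) (fun n => ?_)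
      (x.2.mul_left (‖A‖ ^ 2))
    rw [← mul_pow]
    gcongr
    exact A.le_opNorm _⟩

theorem continuous_mulLeft (M : VonNeumannAlgebra H) (X : Elem M) :
    Continuous[ultraweak M, ultraweak M] (fun Y : Elem M => X * Y) := by
  refine continuous_iInf_rng.2 ?_
  intro q
  rw [continuous_induced_rng]
  have := continuous_pairing M q.1
    (q.2.map (ContinuousLinearMap.adjoint (X : H →L[ℂ] H)))
  convert this using 1
  ext Y
  simp [ultraweakPairing, SqSummable.map, ContinuousLinearMap.adjoint_inner_left]

/-- The functional `X ↦ ⟨X x, y⟩` as an element of the predual. -/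
def vectorFunctional (M : VonNeumannAlgebra H) (x y : H) : Predual M :=
  ⟨(innerSL ℂ y) ∘L (ContinuousLinearMap.apply ℂ H x) ∘L
      (M.toStarSubalgebra.toSubalgebra.toSubmodule.subtypeL), by
    have hs : ∀ z : H, Summable fun n : ℕ => ‖(Pi.single 0 z : ℕ → H) n‖ ^ 2 := fun z =>
      summable_of_ne_finset_zero (s := {0}) fun n hn => by
        have : n ≠ 0 := by simpa using hn
        simp [this]
    have := continuous_pairing M ⟨_, hs x⟩ ⟨_, hs y⟩
    change Continuous[ultraweak M, inferInstance] _
    convert this using 1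
    ext A
    rw [ultraweakPairing, tsum_eq_single 0]
    · simp only [Pi.single_eq_same]
      rfl
    · intro n hn
      simp [hn]⟩

theorem vectorFunctional_apply (M : VonNeumannAlgebra H) (x y : H) (A : Elem M) :
    (vectorFunctional M x y).1 A = ⟪y, (A : H →L[ℂ] H) x⟫_ℂ := rfl


theorem norm_vectorFunctional_le (M : VonNeumannAlgebra H) (x y : H) :
    ‖vectorFunctional M x y‖ ≤ ‖x‖ * ‖y‖ := by
  refine ContinuousLinearMap.opNorm_le_bound _ (by positivity) fun A => ?_
  change ‖⟪y, (A : H →L[ℂ] H) x⟫_ℂ‖ ≤ _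
  calc ‖⟪y, (A : H →L[ℂ] H) x⟫_ℂ‖ ≤ ‖y‖ * ‖(A : H →L[ℂ] H) x‖ := norm_inner_le_norm _ _
    _ ≤ ‖y‖ * (‖A‖ * ‖x‖) := by gcongr; exact (A : H →L[ℂ] H).le_opNorm _
    _ = _ := by ring

theorem ext_of_predual {M : VonNeumannAlgebra H} {A B : Elem M}
    (h : ∀ l : Predual M, l.1 A = l.1 B) : A = B := by
  apply Subtype.ext
  ext x
  refine ext_inner_left ℂ fun y => ?_
  exact h (vectorFunctional M x y)

/-- `ultraweakPairing x y` as a linear functional on `M`. -/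
def pairingLin (M : VonNeumannAlgebra H) (q : SqSummable H × SqSummable H) :
    Elem M →ₗ[ℂ] ℂ where
  toFun A := ultraweakPairing q.1 q.2 (A : H →L[ℂ] H)
  map_add' A B := by
    simp only [ultraweakPairing]
    rw [← (summable_pairing q.1 q.2 _).tsum_add (summable_pairing q.1 q.2 _)]
    simp
  map_smul' c A := by
    simp only [ultraweakPairing]
    rw [RingHom.id_apply, smul_eq_mul, ← tsum_mul_left]
    simp

theorem predual_mem_span (M : VonNeumannAlgebra H) (l : Predual M) :
    (l.1 : Elem M →ₗ[ℂ] ℂ) ∈ Submodule.span ℂ (Set.range (pairingLin M)) := by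
  rw [LinearMap.mem_span_iff_continuous]
  exact l.2

/-- The functional `A ↦ ∑ ⟨A xₙ, yₙ⟩` is the norm-convergent sum of the functionals
`A ↦ ⟨A xₙ, yₙ⟩` in the predual. -/
theorem exists_hasSum_pairing (M : VonNeumannAlgebra H) (q : SqSummable H × SqSummable H) :
    ∃ l : Predual M, (l.1 : Elem M →ₗ[ℂ] ℂ) = pairingLin M q ∧
      HasSum (fun n => vectorFunctional M (q.1.1 n) (q.2.1 n)) l := by
  have hs : Summable fun n => (vectorFunctional M (q.1.1 n) (q.2.1 n)).1 := by
    refine Summable.of_norm_bounded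
      (g := fun n => ‖q.1.1 n‖ ^ 2 + ‖q.2.1 n‖ ^ 2) (q.1.2.add q.2.2) fun n => ?_
    refine (norm_vectorFunctional_le M _ _).trans ?_
    nlinarith [sq_nonneg (‖q.1.1 n‖ - ‖q.2.1 n‖), sq_nonneg ‖q.1.1 n‖, sq_nonneg ‖q.2.1 n‖]
  obtain ⟨l, hl⟩ := hs
  have hval : ∀ A : Elem M, l A = pairingLin M q A := fun A => by
    have h1 := hl.mapL (ContinuousLinearMap.apply ℂ ℂ A)
    exact h1.unique (summable_pairing q.1 q.2 (A : H →L[ℂ] H)).hasSum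
  have hmem : l ∈ Predual M := by
    change Continuous[ultraweak M, inferInstance] l
    have : (l : Elem M → ℂ) = fun A : Elem M => ultraweakPairing q.1 q.2 (A : H →L[ℂ] H) :=
      funext hval
    rw [this]
    exact continuous_pairing M q.1 q.2
  refine ⟨⟨l, hmem⟩, LinearMap.ext hval, ?_⟩
  exact (Topology.IsInducing.hasSum_iff (g := (Predual M).subtype)
    Topology.IsInducing.subtypeVal _ ⟨l, hmem⟩).1 hl

/-- `M` is the dual of its predual. -/
theorem exists_of_predual_dual (M : VonNeumannAlgebra H) (F : Predual M →ₗ[ℂ] ℂ) (C : ℝ)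
    (hC : 0 ≤ C) (hFC : ∀ l, ‖F l‖ ≤ C * ‖l‖) :
    ∃ A : Elem M, (∀ l : Predual M, l.1 A = F l) ∧ ‖A‖ ≤ C := by
  have hFcont : Continuous F := AddMonoidHomClass.continuous_of_bound F C hFC
  have hF : ∀ x y, ‖F (vectorFunctional M x y)‖ ≤ C * ‖x‖ * ‖y‖ := fun x y => by
    refine (hFC _).trans ?_
    rw [mul_assoc]
    gcongr
    exact norm_vectorFunctional_le M x y
  let B : H →L⋆[ℂ] H →L[ℂ] ℂ := LinearMap.mkContinuous₂
    (LinearMap.mk₂'ₛₗ (starRingEnd ℂ) (RingHom.id ℂ)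
      (fun y x => F (vectorFunctional M x y))
      (fun y z x => by
        rw [← map_add]; congr 1; ext A
        exact inner_add_left _ _ _)
      (fun c y x => by
        rw [← map_smul]; congr 1; ext A
        exact inner_smul_left _ _ _)
      (fun y x z => by
        rw [← map_add]; congr 1; ext A
        exact (congrArg _ (map_add (A : H →L[ℂ] H) x z)).trans (inner_add_right _ _ _))
      (fun c y x => by
        rw [RingHom.id_apply, ← map_smul]; congr 1; ext A
        exact (congrArg _ (map_smul (A : H →L[ℂ] H) c x)).trans (inner_smul_right _ _ _)))
    C (fun y x => by
      refine (hF x y).trans (le_of_eq ?_)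
      ring)
  let A : H →L[ℂ] H :=
    ContinuousLinearMap.adjoint (InnerProductSpace.continuousLinearMapOfBilin (𝕜 := ℂ) B)
  have hA : ∀ x y, ⟪y, A x⟫_ℂ = F (vectorFunctional M x y) := fun x y => by
    rw [ContinuousLinearMap.adjoint_inner_right,
      InnerProductSpace.continuousLinearMapOfBilin_apply]
    rfl
  have hmem : A ∈ M.toStarSubalgebra := by
    change A ∈ (M : Set (H →L[ℂ] H))
    rw [← M.centralizer_centralizer]
    intro T hT
    ext x
    refine ext_inner_left ℂ fun y => ?_
    change ⟪y, T (A x)⟫_ℂ = ⟪y, A (T x)⟫_ℂ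
    rw [hA, ← ContinuousLinearMap.adjoint_inner_left, hA]
    congr 1
    ext X
    rw [vectorFunctional_apply, vectorFunctional_apply, ContinuousLinearMap.adjoint_inner_left]
    have := hT (X : H →L[ℂ] H) X.2
    exact congrArg (fun S : H →L[ℂ] H => ⟪y, S x⟫_ℂ) this.symm
  refine ⟨⟨A, hmem⟩, fun l => ?_, ?_⟩
  · have key : ∀ f ∈ Submodule.span ℂ (Set.range (pairingLin M)),
        ∃ k : Predual M, (k.1 : Elem M →ₗ[ℂ] ℂ) = f ∧ k.1 ⟨A, hmem⟩ = F k := by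
      intro f hf
      induction hf using Submodule.span_induction with
      | mem f hf =>
        obtain ⟨q, rfl⟩ := hf
        obtain ⟨k, hk, hsum⟩ := exists_hasSum_pairing M q
        refine ⟨k, hk, ?_⟩
        have h1 := hsum.map F hFcont
        have h2 : k.1 ⟨A, hmem⟩ = ultraweakPairing q.1 q.2 A :=
          LinearMap.congr_fun hk ⟨A, hmem⟩
        rw [h2]
        refine HasSum.unique (summable_pairing q.1 q.2 A).hasSum ?_
        simpa only [hA, Function.comp_def] using h1
      | zero => exact ⟨0, rfl, by simp⟩
      | add f g _ _ hf hg =>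
        obtain ⟨k, rfl, hk⟩ := hf
        obtain ⟨m, rfl, hm⟩ := hg
        exact ⟨k + m, rfl, by rw [map_add, ← hk, ← hm]; rfl⟩
      | smul c f _ hf =>
        obtain ⟨k, rfl, hk⟩ := hf
        exact ⟨c • k, rfl, by rw [map_smul, ← hk]; rfl⟩
    obtain ⟨k, hk, h⟩ := key _ (predual_mem_span M l)
    have : k = l := Subtype.ext (ContinuousLinearMap.coe_injective hk)
    rwa [this] at h
  · refine ContinuousLinearMap.opNorm_le_bound A hC fun x => ?_
    by_cases h0 : ‖A x‖ = 0
    · rw [h0]; positivity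
    · have h1 : ‖A x‖ ^ 2 ≤ C * ‖x‖ * ‖A x‖ := by
        have := hF x (A x)
        rw [← hA, inner_self_eq_norm_sq_to_K] at this
        simpa using this
      have h2 : 0 < ‖A x‖ := lt_of_le_of_ne (norm_nonneg _) (Ne.symm h0)
      nlinarith

/-! ### Weak-star continuous maps, traces and stable maps -/

/-- Membership in `B_w(M)`: continuity for the weak-star topology. -/
def IsWeakStarContinuous {M : VonNeumannAlgebra H} (φ : Elem M →L[ℂ] Elem M) : Prop :=
  Continuous[ultraweak M, ultraweak M] φ

/-- The operator `φ_*` on the predual whose adjoint is `φ`, that is `[φ_* l, X] = [l, φ X]`. -/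
def preadjoint {M : VonNeumannAlgebra H} (φ : Elem M →L[ℂ] Elem M)
    (hφ : IsWeakStarContinuous φ) : Predual M →ₗ[ℂ] Predual M where
  toFun l := ⟨l.1 ∘L φ, by
    let _ := ultraweak M
    exact Continuous.comp (g := l.1) (f := φ) l.2 hφ⟩
  map_add' _ _ := rfl
  map_smul' _ _ := rfl

/-- A faithful normal (finite) trace: an ultraweakly continuous linear functional `τ` on `M` with
`τ(AB) = τ(BA)`, and with `τ(A) ≥ 0` and `τ(A) = 0 → A = 0` for every positive `A`. -/
structure FaithfulNormalTrace (M : VonNeumannAlgebra H) where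
  /-- The trace as an element of the predual. -/
  toPredual : Predual M
  trace_comm : ∀ A B : Elem M, toPredual.1 (A * B) = toPredual.1 (B * A)
  nonneg : ∀ A : Elem M, (A : H →L[ℂ] H).IsPositive →
    0 ≤ (toPredual.1 A).re ∧ (toPredual.1 A).im = 0
  faithful : ∀ A : Elem M, (A : H →L[ℂ] H).IsPositive → toPredual.1 A = 0 → A = 0

/-- The map `Ψ_τ : M → M_*`, `X ↦ l_X`, where `l_X(Y) = τ(XY)`. -/
def traceMap {M : VonNeumannAlgebra H} (τ : FaithfulNormalTrace M) :
    Elem M →ₗ[ℂ] Predual M where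
  toFun X := ⟨τ.toPredual.1 ∘L ContinuousLinearMap.mul ℂ (Elem M) X, by
    let _ := ultraweak M
    exact Continuous.comp (g := τ.toPredual.1) (f := fun Y : Elem M => X * Y)
      τ.toPredual.2 (continuous_mulLeft M X)⟩
  map_add' X Y := by ext Z; simp
  map_smul' c X := by ext Z; simp

theorem traceMap_apply {M : VonNeumannAlgebra H} (τ : FaithfulNormalTrace M) (X Y : Elem M) :
    (traceMap τ X).1 Y = τ.toPredual.1 (X * Y) := rfl

theorem traceMap_injective {M : VonNeumannAlgebra H} (τ : FaithfulNormalTrace M) :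
    Function.Injective (traceMap τ) := by
  rw [injective_iff_map_eq_zero]
  intro X hX
  have h1 : τ.toPredual.1 (X * star X) = 0 := by
    rw [← traceMap_apply, hX]; rfl
  have h2 : X * star X = 0 := τ.faithful _
    (ContinuousLinearMap.isPositive_self_comp_adjoint (X : H →L[ℂ] H)) h1
  exact CStarRing.mul_star_self_eq_zero_iff X |>.1 h2

/-- Membership of `φ` in the class of `τ`-`M`-stable maps: `φ` is weak-star continuous and `φ_*`
maps the range of `Ψ_τ` into itself. -/
def IsTauStable {M : VonNeumannAlgebra H} (τ : FaithfulNormalTrace M)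
    (φ : Elem M →L[ℂ] Elem M) : Prop :=
  ∃ hφ : IsWeakStarContinuous φ,
    ∀ l ∈ LinearMap.range (traceMap τ), preadjoint φ hφ l ∈ LinearMap.range (traceMap τ)

/-- The linear map `Ψ_τ⁻¹ φ_* Ψ_τ` on `M`, for a `τ`-`M`-stable map `φ`. -/
def tauDualLin {M : VonNeumannAlgebra H} (τ : FaithfulNormalTrace M)
    (φ : Elem M →L[ℂ] Elem M) (hφ : IsTauStable τ φ) : Elem M →ₗ[ℂ] Elem M :=
  (LinearEquiv.ofInjective (traceMap τ) (traceMap_injective τ)).symm.toLinearMap ∘ₗ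
    ((preadjoint φ hφ.1).restrict hφ.2) ∘ₗ (traceMap τ).rangeRestrict

theorem traceMap_tauDualLin {M : VonNeumannAlgebra H} (τ : FaithfulNormalTrace M)
    (φ : Elem M →L[ℂ] Elem M) (hφ : IsTauStable τ φ) (X : Elem M) :
    traceMap τ (tauDualLin τ φ hφ X) = preadjoint φ hφ.1 (traceMap τ X) := by
  have := LinearEquiv.apply_symm_apply
    (LinearEquiv.ofInjective (traceMap τ) (traceMap_injective τ))
    ((preadjoint φ hφ.1).restrict hφ.2 ((traceMap τ).rangeRestrict X))
  exact congrArg Subtype.val this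

theorem trace_tauDualLin {M : VonNeumannAlgebra H} (τ : FaithfulNormalTrace M)
    (φ : Elem M →L[ℂ] Elem M) (hφ : IsTauStable τ φ) (X Y : Elem M) :
    τ.toPredual.1 (tauDualLin τ φ hφ X * Y) = τ.toPredual.1 (X * φ Y) := by
  rw [← traceMap_apply, traceMap_tauDualLin]
  rfl

instance completeSpace_elem (M : VonNeumannAlgebra H) : CompleteSpace (Elem M) := by
  have : IsClosed (M : Set (H →L[ℂ] H)) := ?_
  · exact this.completeSpace_coe
  rw [← M.centralizer_centralizer]
  exact Set.isClosed_centralizer _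

/-- The `τ`-dual `φ̂_τ = Ψ_τ⁻¹ φ_* Ψ_τ` of a `τ`-`M`-stable map `φ`, as a bounded operator on `M`
(it is bounded by the closed graph theorem). -/
def tauDual {M : VonNeumannAlgebra H} (τ : FaithfulNormalTrace M)
    (φ : Elem M →L[ℂ] Elem M) (hφ : IsTauStable τ φ) : Elem M →L[ℂ] Elem M where
  toLinearMap := tauDualLin τ φ hφ
  cont := by
    refine (tauDualLin τ φ hφ).continuous_of_seq_closed_graph fun u x y hu hTu => ?_
    apply traceMap_injective τ
    ext Z
    rw [traceMap_apply, traceMap_apply, trace_tauDualLin]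
    have h1 : Tendsto (fun n => τ.toPredual.1 (tauDualLin τ φ hφ (u n) * Z)) atTop
        (𝓝 (τ.toPredual.1 (y * Z))) :=
      (τ.toPredual.1.continuous.tendsto _).comp (hTu.mul_const Z)
    have h2 : Tendsto (fun n => τ.toPredual.1 (u n * φ Z)) atTop
        (𝓝 (τ.toPredual.1 (x * φ Z))) :=
      (τ.toPredual.1.continuous.tendsto _).comp (hu.mul_const (φ Z))
    simp only [trace_tauDualLin] at h1
    exact tendsto_nhds_unique h1 h2

/-! ### Banach limits, almost convergence, gauges -/

/-- The left shift `(uₙ) ↦ (uₙ₊₁)` on bounded sequences. -/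
def shift (u : ℕ+ →ᵇ ℂ) : ℕ+ →ᵇ ℂ :=
  u.compContinuous ⟨fun n => n + 1, continuous_of_discreteTopology⟩

/-- Banach limits on the space of bounded complex sequences `(uₙ)`, `n ≥ 1`. -/
structure IsBanachLimit (L : StrongDual ℂ (ℕ+ →ᵇ ℂ)) : Prop where
  norm_eq : ‖L‖ = 1
  map_one : L 1 = 1
  map_shift : ∀ u, L (shift u) = L u

/-- The bounded sequence `(uₙ)` is almost convergent to `c`:
`sup_k |(u_k + ⋯ + u_{k+n}) / (n + 1) - c| → 0` as `n → ∞`. -/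
def AlmostConvergesTo (u : ℕ+ → ℂ) (c : ℂ) : Prop :=
  BddAbove (Set.range fun n => ‖u n‖) ∧
    Tendsto (fun n : ℕ+ => ⨆ k : ℕ+,
      ‖(1 / (((n : ℕ) : ℂ) + 1)) * ∑ i ∈ Finset.Icc k (k + n), u i - c‖) atTop (𝓝 0)

/-- The sequence `(uₙ)` is strongly almost convergent to `c`: `(|uₙ - c|)` is almost convergent
to `0`. -/
def StronglyAlmostConvergesTo (u : ℕ+ → ℂ) (c : ℂ) : Prop :=
  AlmostConvergesTo (fun n => (‖u n - c‖ : ℂ)) 0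

/-- The sequence `(φₙ)` is weakly almost convergent to `φ`: `[l, φₙ(X) - φ(X)]` almost converges
to `0` for every `l ∈ M_*` and `X ∈ M`. -/
def WeaklyAlmostConvergesTo {M : VonNeumannAlgebra H} (φs : ℕ+ → Elem M →L[ℂ] Elem M)
    (φ : Elem M →L[ℂ] Elem M) : Prop :=
  ∀ (l : Predual M) (X : Elem M), AlmostConvergesTo (fun n => l.1 (φs n X - φ X)) 0

/-- A gauge: a positive sequence `p` such that `p(n+1)/p(n)` is strongly almost convergent to some
`c_p > 0`. The number `c_p`, which `p` determines, is kept as the field `rate`. -/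
structure Gauge where
  toFun : ℕ+ → ℝ
  pos : ∀ n, 0 < toFun n
  rate : ℝ
  rate_pos : 0 < rate
  ratio : StronglyAlmostConvergesTo (fun n => ((toFun (n + 1) / toFun n : ℝ) : ℂ)) (rate : ℂ)

instance : CoeFun Gauge fun _ => ℕ+ → ℝ := ⟨Gauge.toFun⟩

/-- The sequence `c_pⁿ / p(n)`. -/
def Gauge.quotient (p : Gauge) (n : ℕ+) : ℂ := ((p.rate ^ (n : ℕ) / p n : ℝ) : ℂ)

/-- The value of a functional `L` on `ℓ^∞` at a sequence `u`; it is set to `0` if `u` is not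
bounded. -/
def evalSeq (L : StrongDual ℂ (ℕ+ →ᵇ ℂ)) (u : ℕ+ → ℂ) : ℂ :=
  open Classical in
  if h : ∃ C, ∀ n, ‖u n‖ ≤ C then
    L (BoundedContinuousFunction.ofNormedAddCommGroupDiscrete u h.choose h.choose_spec)
  else 0

/-- `γ_L(p) = L((c_pⁿ / p(n))ₙ)`. -/
def gaugeLimit (L : StrongDual ℂ (ℕ+ →ᵇ ℂ)) (p : Gauge) : ℂ := evalSeq L p.quotient

/-- The sequence `Φ` is dominated by the gauge `p`. -/
def IsDominated {M : VonNeumannAlgebra H} (Φ : ℕ+ → Elem M →L[ℂ] Elem M) (p : Gauge) : Prop :=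
  ∀ n, ‖Φ n‖ ≤ p n

theorem pairing_bound {M : VonNeumannAlgebra H} {Φ : ℕ+ → Elem M →L[ℂ] Elem M} {p : Gauge}
    (hΦ : IsDominated Φ p) (l : Predual M) (X : Elem M) (n : ℕ+) :
    ‖l.1 (Φ n X) * ((p n : ℝ) : ℂ)⁻¹‖ ≤ ‖l‖ * ‖X‖ := by
  have hp := p.pos n
  rw [norm_mul, norm_inv, Complex.norm_real, Real.norm_of_nonneg hp.le,
    ← div_eq_mul_inv, div_le_iff₀ hp]
  calc ‖l.1 (Φ n X)‖ ≤ ‖l.1‖ * (‖Φ n‖ * ‖X‖) :=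
        (l.1.le_opNorm _).trans (by gcongr; exact (Φ n).le_opNorm X)
    _ ≤ ‖l.1‖ * (p n * ‖X‖) := by gcongr; exact hΦ n
    _ = _ := by rw [Submodule.coe_norm]; ring

/-- The bounded sequence `[l, φₙ(X)] p(n)⁻¹`. -/
def pairingSeq {M : VonNeumannAlgebra H} {Φ : ℕ+ → Elem M →L[ℂ] Elem M} {p : Gauge}
    (hΦ : IsDominated Φ p) (l : Predual M) (X : Elem M) : ℕ+ →ᵇ ℂ :=
  BoundedContinuousFunction.ofNormedAddCommGroupDiscrete
    (fun n => l.1 (Φ n X) * ((p n : ℝ) : ℂ)⁻¹) (‖l‖ * ‖X‖) (pairing_bound hΦ l X)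

theorem norm_pairingSeq_le {M : VonNeumannAlgebra H} {Φ : ℕ+ → Elem M →L[ℂ] Elem M} {p : Gauge}
    (hΦ : IsDominated Φ p) (l : Predual M) (X : Elem M) :
    ‖pairingSeq hΦ l X‖ ≤ ‖l‖ * ‖X‖ :=
  BoundedContinuousFunction.norm_ofNormedAddCommGroup_le _ (by positivity) (pairing_bound hΦ l X)

/-- There is exactly one bounded operator `E` on `M` with
`[l, E(X)] = L(([l, φₙ(X)] p(n)⁻¹)ₙ)` for all `l ∈ M_*` and `X ∈ M`. -/
theorem existsUnique_limitOperator {M : VonNeumannAlgebra H} {Φ : ℕ+ → Elem M →L[ℂ] Elem M}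
    {p : Gauge} (hΦ : IsDominated Φ p) (L : StrongDual ℂ (ℕ+ →ᵇ ℂ)) :
    ∃! E : Elem M →L[ℂ] Elem M,
      ∀ (l : Predual M) (X : Elem M), l.1 (E X) = L (pairingSeq hΦ l X) := by
  have hadd : ∀ l X Y, pairingSeq hΦ l (X + Y) = pairingSeq hΦ l X + pairingSeq hΦ l Y := by
    intro l X Y; ext n; simp [pairingSeq, add_mul]
  have hsmul : ∀ (c : ℂ) l X, pairingSeq hΦ l (c • X) = c • pairingSeq hΦ l X := by
    intro c l X; ext n; simp [pairingSeq, mul_assoc]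
  let F : Elem M → Predual M →ₗ[ℂ] ℂ := fun X =>
      { toFun := fun l => L (pairingSeq hΦ l X)
        map_add' := fun l k => by
          rw [← map_add]; congr 1; ext n; simp [pairingSeq, add_mul]
        map_smul' := fun c l => by
          rw [RingHom.id_apply, ← map_smul]; congr 1; ext n; simp [pairingSeq, mul_assoc] }
  have hF : ∀ X l, ‖F X l‖ ≤ ‖L‖ * ‖X‖ * ‖l‖ := fun X l => by
    refine (L.le_opNorm _).trans ?_
    rw [mul_assoc]
    gcongr
    rw [mul_comm]
    exact norm_pairingSeq_le hΦ l X
  choose e he hn using fun X =>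
    exists_of_predual_dual M (F X) (‖L‖ * ‖X‖) (by positivity) (hF X)
  have he' : ∀ X (l : Predual M), l.1 (e X) = L (pairingSeq hΦ l X) := he
  let E : Elem M →L[ℂ] Elem M := LinearMap.mkContinuous
    { toFun := e
      map_add' := fun X Y => ext_of_predual fun l => by
        rw [map_add, he', he', he', hadd, map_add]
      map_smul' := fun c X => ext_of_predual fun l => by
        rw [map_smul, he', he', hsmul, map_smul, RingHom.id_apply] }
    ‖L‖ hn
  refine ⟨E, fun l X => he' X l, fun E' hE' => ?_⟩
  refine ContinuousLinearMap.ext fun X => ext_of_predual fun l => ?_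
  rw [hE']
  exact (he' X l).symm

/-- The limit operator `E_{Φ,L}`. -/
def limitOperator {M : VonNeumannAlgebra H} {Φ : ℕ+ → Elem M →L[ℂ] Elem M}
    {p : Gauge} (hΦ : IsDominated Φ p) (L : StrongDual ℂ (ℕ+ →ᵇ ℂ)) : Elem M →L[ℂ] Elem M :=
  (existsUnique_limitOperator hΦ L).choose

theorem limitOperator_spec {M : VonNeumannAlgebra H} {Φ : ℕ+ → Elem M →L[ℂ] Elem M}
    {p : Gauge} (hΦ : IsDominated Φ p) (L : StrongDual ℂ (ℕ+ →ᵇ ℂ))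
    (l : Predual M) (X : Elem M) :
    l.1 (limitOperator hΦ L X) = L (pairingSeq hΦ l X) :=
  (existsUnique_limitOperator hΦ L).choose_spec.1 l X

end FiniteVN

end

open FiniteVN

/-! The identity $\tau(\widehat\phi(X)Y)=\tau(X\phi(Y))$ passes through a Banach limit, so
$E_{\Phi,L}$ and $E_{\widehat\Phi,L}$ are transposes of each other for $\tau(XY)$. What is not
formal in (i) is weak-star continuity of $E_{\Phi,L}$. The transpose relation shows that $l\mapsto
l\circ E_{\Phi,L}$ sends the functionals $\tau(X\,\cdot)$ into $M_*$; these are norm-dense in $M_*$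
(`mem_closure_range_traceMap`) and $M_*$ is norm-closed in $M^*$ (`isClosed_predual`), so it sends
all of $M_*$ into $M_*$. Closedness comes from writing every functional in the closure as an
$\ell^1$ combination of vector functionals.

Once $E_{\Phi,L_2}$ is weak-star continuous it can be moved onto $l$ in the formula defining
$E_{\Phi,L_1}$, which gives (ii).

For powers, shift invariance of $L$ and strong almost convergence of $p(n+1)/p(n)$ give $\psi
E_L=c_pE_L$. Hence $[l,\psi^nE_L(X)]/p(n)=[l,E_L(X)]\,c_p^n/p(n)$, and applying $K$ yields
$E_KE_L=\gamma_K(p)E_L$; commutativity does the rest. If $c_p^n/p(n)$ almost converges to $d\ne0$,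
every $\gamma_L(p)$ is $d$, all $E_L$ coincide, and Lorentz's theorem turns this into weak almost
convergence. -/

namespace FiniteVN

/-! ### The predual is norm-closed in the dual -/

/-- The successive approximation argument of the open mapping theorem, relative to a submodule of
the target: approximate preimages with controlled norm yield exact preimages. -/
theorem exists_preimage_of_approx {E F : Type*} [NormedAddCommGroup E] [NormedSpace ℂ E]
    [CompleteSpace E] [NormedAddCommGroup F] [NormedSpace ℂ F] (f : E →L[ℂ] F)
    (V : Submodule ℂ F) (C : ℝ)
    (h : ∀ y ∈ V, ∃ x, f x ∈ V ∧ ‖y - f x‖ ≤ 1 / 2 * ‖y‖ ∧ ‖x‖ ≤ C * ‖y‖) :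
    ∀ y ∈ V, ∃ x, f x = y := by
  choose! g hV hle hg using h
  intro y hy
  let r : F → F := fun z => z - f (g z)
  have hrV : ∀ n : ℕ, r^[n] y ∈ V := by
    intro n
    induction n with
    | zero => simpa using hy
    | succ n IH =>
      rw [Function.iterate_succ_apply']
      exact V.sub_mem IH (hV _ IH)
  have hnle : ∀ n : ℕ, ‖r^[n] y‖ ≤ (1 / 2) ^ n * ‖y‖ := by
    intro n
    induction n with
    | zero => simp
    | succ n IH =>
      rw [Function.iterate_succ_apply', pow_succ', mul_assoc]
      exact (hle _ (hrV n)).trans (by gcongr)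
  have su : Summable fun n => g (r^[n] y) := by
    -- No sign is assumed for `C`, hence the absolute value in the majorant.
    refine Summable.of_norm_bounded (g := fun n : ℕ => (1 / 2 : ℝ) ^ n * (|C| * ‖y‖))
      (Summable.mul_right _ (summable_geometric_of_lt_one (by simp) (by norm_num))) fun n => ?_
    calc ‖g (r^[n] y)‖ ≤ C * ‖r^[n] y‖ := hg _ (hrV n)
      _ ≤ |C| * ((1 / 2) ^ n * ‖y‖) := by
        gcongr
        · exact le_abs_self C
        · exact hnle n
      _ = _ := by ring
  have hsum : ∀ n : ℕ, f (∑ i ∈ Finset.range n, g (r^[i] y)) = y - r^[n] y := by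
    intro n
    induction n with
    | zero => simp
    | succ n IH =>
      rw [Finset.sum_range_succ, f.map_add, IH, Function.iterate_succ_apply', sub_add]
  refine ⟨∑' n, g (r^[n] y), ?_⟩
  have h1 := (f.continuous.tendsto _).comp su.hasSum.tendsto_sum_nat
  simp only [Function.comp_def, hsum] at h1
  have h2 : Tendsto (fun n => y - r^[n] y) atTop (𝓝 (y - 0)) := by
    refine tendsto_const_nhds.sub (squeeze_zero_norm hnle ?_)
    simpa using (tendsto_pow_atTop_nhds_zero_of_lt_one (r := (1 / 2 : ℝ))
      (by norm_num) (by norm_num)).mul_const ‖y‖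
  rw [sub_zero] at h2
  exact tendsto_nhds_unique h1 h2

section Synthesis

variable {ι F : Type*} [NormedAddCommGroup F] [NormedSpace ℂ F]

theorem summable_norm_lp_one (c : lp (fun _ : ι => ℂ) 1) : Summable fun i => ‖c i‖ := by
  simpa using (lp.memℓp c).summable (by simp)

theorem norm_lp_one (c : lp (fun _ : ι => ℂ) 1) : ‖c‖ = ∑' i, ‖c i‖ := by
  simpa using lp.norm_eq_tsum_rpow (p := 1) (by simp) c

theorem summable_norm_lp_one_smul {v : ι → F} (hv : ∀ i, ‖v i‖ ≤ 1)
    (c : lp (fun _ : ι => ℂ) 1) : Summable fun i => ‖c i • v i‖ := by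
  refine Summable.of_nonneg_of_le (fun i => norm_nonneg _) (fun i => ?_) (summable_norm_lp_one c)
  rw [norm_smul]
  exact mul_le_of_le_one_right (norm_nonneg _) (hv i)

/-- The operator `c ↦ ∑ cᵢ vᵢ` on `ℓ¹(ι)` defined by a family `v` in the unit ball. -/
noncomputable def synthesis [CompleteSpace F] (v : ι → F) (hv : ∀ i, ‖v i‖ ≤ 1) : lp (fun _ : ι => ℂ) 1 →L[ℂ] F :=
  LinearMap.mkContinuous
    { toFun := fun c => ∑' i, c i • v i
      map_add' := fun c d => by
        rw [← (summable_norm_lp_one_smul hv c).of_norm.tsum_add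
          (summable_norm_lp_one_smul hv d).of_norm]
        simp [add_smul]
      map_smul' := fun a c => by
        rw [RingHom.id_apply, ← (summable_norm_lp_one_smul hv c).of_norm.tsum_const_smul]
        simp [mul_smul] }
    1 fun c => by
      rw [one_mul, norm_lp_one]
      refine (norm_tsum_le_tsum_norm (summable_norm_lp_one_smul hv c)).trans ?_
      refine (summable_norm_lp_one_smul hv c).tsum_le_tsum (fun i => ?_) (summable_norm_lp_one c)
      rw [norm_smul]
      exact mul_le_of_le_one_right (norm_nonneg _) (hv i)

theorem hasSum_synthesis [CompleteSpace F] (v : ι → F) (hv : ∀ i, ‖v i‖ ≤ 1) (c : lp (fun _ : ι => ℂ) 1) :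
    HasSum (fun i => c i • v i) (synthesis v hv c) :=
  (summable_norm_lp_one_smul hv c).of_norm.hasSum

theorem synthesis_single [CompleteSpace F] [DecidableEq ι] (v : ι → F) (hv : ∀ i, ‖v i‖ ≤ 1) (i : ι) (a : ℂ) :
    synthesis v hv (lp.single 1 i a) = a • v i := by
  refine (hasSum_synthesis v hv _).unique ?_
  have h := hasSum_single (f := fun j => (lp.single (E := fun _ : ι => ℂ) 1 i a) j • v j) i
    fun j hj => by rw [lp.single_apply_ne _ _ _ hj, zero_smul]
  rwa [lp.single_apply_self] at h

end Synthesis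

variable {H : Type*} [NormedAddCommGroup H] [InnerProductSpace ℂ H] [CompleteSpace H]
  {M : VonNeumannAlgebra H}

/-- A norm-convergent sum of vector functionals with square-summable vectors is ultraweakly
continuous. -/
theorem mem_predual_of_hasSum {ι : Type*} [Countable ι] (x y : ι → H)
    (hx : Summable fun i => ‖x i‖ ^ 2) (hy : Summable fun i => ‖y i‖ ^ 2)
    {l : StrongDual ℂ (Elem M)} (hl : HasSum (fun i => (vectorFunctional M (x i) (y i)).1) l) :
    l ∈ Predual M := by
  -- Ultraweak pairings are indexed by `ℕ`: transport the families along an injection and extend by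
  -- zero.
  obtain ⟨e, he⟩ := Countable.exists_injective_nat ι
  have key : ∀ z : ι → H, (Summable fun i => ‖z i‖ ^ 2) →
      Summable fun n => ‖Function.extend e z 0 n‖ ^ 2 := fun z hz => by
    rw [← summable_extend_zero he] at hz
    refine hz.congr fun n => ?_
    by_cases hn : ∃ i, e i = n
    · obtain ⟨i, rfl⟩ := hn
      simp [he.extend_apply]
    · simp [Function.extend_apply' _ _ _ hn]
  obtain ⟨k, -, hk⟩ := exists_hasSum_pairing M (⟨_, key x hx⟩, ⟨_, key y hy⟩)
  have hk' := hk.mapL (Predual M).subtypeL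
  have hl' : HasSum (Function.extend e (fun i => (vectorFunctional M (x i) (y i)).1) 0) l :=
    (hasSum_extend_zero he).2 hl
  have : l = k.1 := hl'.unique <| by
    refine hk'.congr_fun fun n => ?_
    by_cases hn : ∃ i, e i = n
    · obtain ⟨i, rfl⟩ := hn
      simp [he.extend_apply]
    · simp only [Function.extend_apply' _ _ _ hn]
      ext A
      exact (inner_zero_left _).symm
  rw [this]
  exact k.2

/-- The family of vector functionals of pairs of unit vectors. -/
noncomputable def unitFunctional (M : VonNeumannAlgebra H)
    (q : Metric.sphere (0 : H) 1 × Metric.sphere (0 : H) 1) : StrongDual ℂ (Elem M) :=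
  (vectorFunctional M q.1 q.2).1

theorem norm_unitFunctional_le (q : Metric.sphere (0 : H) 1 × Metric.sphere (0 : H) 1) :
    ‖unitFunctional M q‖ ≤ 1 := by
  refine (norm_vectorFunctional_le M q.1.1 q.2.1).trans ?_
  simp

/-- An $\ell^1$ weight splits as $w=(w/\sqrt{|w|})\sqrt{|w|}$, one factor for each vector, which
makes both families square-summable. Restricting to the support makes the index set countable and
the divisor nonzero. -/
theorem mem_predual_of_hasSum_smul_unitFunctional
    (w : Metric.sphere (0 : H) 1 × Metric.sphere (0 : H) 1 → ℂ) (hs : Summable fun q => ‖w q‖)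
    {l : StrongDual ℂ (Elem M)} (hl : HasSum (fun q => w q • unitFunctional M q) l) :
    l ∈ Predual M := by
  let S := Function.support fun q => ‖w q‖
  have : Countable S := hs.countable_support.to_subtype
  let s : S → ℝ := fun q => √‖w q‖
  have hs2 : ∀ q, s q ^ 2 = ‖w q‖ := fun q => Real.sq_sqrt (norm_nonneg _)
  have hs0 : ∀ q, s q ≠ 0 := fun q h => q.2 ((hs2 q).symm.trans (by simp [h]))
  refine mem_predual_of_hasSum (ι := S) (fun q => (w q / s q) • q.1.1.1)
    (fun q => (s q : ℂ) • q.1.2.1) ?_ ?_ ?_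
  · refine (hs.subtype S).congr fun q => ?_
    have := hs0 q
    simp only [Function.comp_apply, norm_smul, norm_div, Complex.norm_real,
      norm_eq_of_mem_sphere, mul_one, div_pow, Real.norm_eq_abs, sq_abs]
    rw [hs2, sq, mul_div_assoc, div_self q.2, mul_one]
  · refine (hs.subtype S).congr fun q => ?_
    simp only [Function.comp_apply, norm_smul, Complex.norm_real,
      norm_eq_of_mem_sphere, mul_one, Real.norm_eq_abs, sq_abs]
    rw [hs2]
  · have h2 : HasSum (fun q : S => w q • unitFunctional M q) l := by
      refine (hasSum_subtype_iff_of_support_subset (f := fun q => w q • unitFunctional M q) ?_).2 hl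
      intro q hq hq0
      apply hq
      have : w q = 0 := norm_eq_zero.1 hq0
      exact ContinuousLinearMap.ext fun A =>
        (congrArg (· * unitFunctional M q A) this).trans (zero_mul _)
    refine h2.congr_fun fun q => ?_
    have := hs0 q
    ext A
    change ⟪(s q : ℂ) • q.1.2.1, (A : H →L[ℂ] H) ((w q / s q) • q.1.1.1)⟫_ℂ =
      w q * ⟪q.1.2.1, (A : H →L[ℂ] H) q.1.1.1⟫_ℂ
    rw [map_smul, inner_smul_left, inner_smul_right, Complex.conj_ofReal, ← mul_assoc,
      mul_div_cancel₀ _ (Complex.ofReal_ne_zero.2 this)]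

/-- Hahn–Banach: a functional separating `l` from the image of the ball of radius `‖l‖` acts on the
predual as evaluation at some `A`. Its bound `u` on that image forces `‖l‖ * ‖A‖ ≤ u`, so it cannot
exceed `u` at `l`. -/
theorem exists_synthesis_approx (l : Predual M) {ε : ℝ} (hε : 0 < ε) :
    ∃ c, ‖c‖ ≤ ‖l‖ ∧
      ‖l.1 - synthesis (unitFunctional M) norm_unitFunctional_le c‖ < ε := by
  classical
  rcases eq_or_lt_of_le (norm_nonneg l) with h0 | h0
  · refine ⟨0, by simp, ?_⟩
    have : l.1 = 0 := norm_eq_zero.1 h0.symm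
    simpa [this] using hε
  set T := synthesis (unitFunctional M) norm_unitFunctional_le
  have hmem : l.1 ∈ closure (T '' Metric.closedBall 0 ‖l‖) := by
    by_contra hl
    obtain ⟨f, u, hu, hfl⟩ := RCLike.geometric_hahn_banach_closed_point (𝕜 := ℂ)
      (((convex_closedBall 0 ‖l‖).linear_image
        (T.toLinearMap.restrictScalars ℝ)).closure) isClosed_closure hl
    obtain ⟨C, hC0, hC⟩ := f.bound
    obtain ⟨A, hA, -⟩ := exists_of_predual_dual M
      (f.toLinearMap ∘ₗ (Predual M).subtype) C hC0.le fun k => hC k.1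
    have hT : ∀ c, ‖c‖ ≤ ‖l‖ → (f (T c)).re < u := fun c hc =>
      hu _ (subset_closure ⟨c, by simpa using hc, rfl⟩)
    have hu0 : 0 < u := by simpa using hT 0 (by simp)
    have hAn : ‖A‖ ≤ u / ‖l‖ := by
      change ‖(A : H →L[ℂ] H)‖ ≤ _
      refine ContinuousLinearMap.opNorm_le_of_unit_norm (by positivity) fun x hx => ?_
      by_cases hAx : ‖(A : H →L[ℂ] H) x‖ = 0
      · rw [hAx]; positivity
      set a := ‖(A : H →L[ℂ] H) x‖ with ha
      have hy : ‖((a : ℂ)⁻¹ • (A : H →L[ℂ] H) x)‖ = 1 := by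
        rw [norm_smul, norm_inv, Complex.norm_real, ha, norm_norm, inv_mul_cancel₀ hAx]
      let q : Metric.sphere (0 : H) 1 × Metric.sphere (0 : H) 1 :=
        (⟨x, by simpa using hx⟩, ⟨_, by simpa using hy⟩)
      -- The pair of `x` and the normalized vector `A x` recovers `‖A x‖`; the weight `‖l‖` puts the
      -- test point on the boundary of the ball.
      have h1 := hT (lp.single 1 q (‖l‖ : ℂ)) (by rw [lp.norm_single (by simp)]; simp)
      have h2 : f (unitFunctional M q) = a := by
        have := hA (vectorFunctional M q.1 q.2)
        refine this.symm.trans ?_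
        rw [vectorFunctional_apply]
        change ⟪(a : ℂ)⁻¹ • (A : H →L[ℂ] H) x, (A : H →L[ℂ] H) x⟫_ℂ = a
        rw [inner_smul_left, inner_self_eq_norm_sq_to_K, ← ha]
        have : (a : ℂ) ≠ 0 := Complex.ofReal_ne_zero.2 hAx
        simp
        field_simp
      rw [synthesis_single, map_smul, h2, smul_eq_mul, ← Complex.ofReal_mul,
        Complex.ofReal_re] at h1
      rw [le_div_iff₀ h0, mul_comm]
      exact h1.le
    have h3 : ‖f l.1‖ ≤ u := by
      have := hA l
      change l.1 A = f l.1 at this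
      rw [← this]
      refine (l.1.le_opNorm A).trans ?_
      rw [le_div_iff₀ h0, mul_comm] at hAn
      exact hAn
    exact absurd (hfl.trans_le ((Complex.re_le_norm _).trans h3)) (lt_irrefl _)
  obtain ⟨_, ⟨c, hc, rfl⟩, hd⟩ := Metric.mem_closure_iff.1 hmem ε hε
  exact ⟨c, by simpa using hc, by rwa [dist_eq_norm] at hd⟩

/-- The predual is norm-closed in the dual. -/
theorem isClosed_predual (M : VonNeumannAlgebra H) :
    IsClosed (Predual M : Set (StrongDual ℂ (Elem M))) := by
  have hV : ∀ c, synthesis (unitFunctional M) norm_unitFunctional_le c ∈ Predual M := fun c =>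
    mem_predual_of_hasSum_smul_unitFunctional _ (summable_norm_lp_one c) (hasSum_synthesis _ _ c)
  have key := exists_preimage_of_approx
    (synthesis (unitFunctional M) norm_unitFunctional_le) (Predual M).topologicalClosure 2 ?_
  · refine isClosed_of_closure_subset fun l hl => ?_
    obtain ⟨c, rfl⟩ := key l hl
    exact hV c
  intro y hy
  rcases eq_or_lt_of_le (norm_nonneg y) with h0 | h0
  · have : y = 0 := norm_eq_zero.1 h0.symm
    exact ⟨0, by simp, by simp [this], by simp⟩
  -- Two errors of `‖y‖ / 4` add up to the required half, and `‖c‖ ≤ ‖l‖ ≤ 5/4 * ‖y‖` is within the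
  -- constant 2.
  obtain ⟨l, hl, hyl⟩ := Metric.mem_closure_iff.1 hy (‖y‖ / 4) (by positivity)
  obtain ⟨c, hc, hlc⟩ := exists_synthesis_approx (M := M) ⟨l, hl⟩ (ε := ‖y‖ / 4) (by positivity)
  rw [dist_eq_norm] at hyl
  refine ⟨c, (Predual M).le_topologicalClosure (hV c), ?_, ?_⟩
  · have := norm_sub_le_norm_sub_add_norm_sub y l
      (synthesis (unitFunctional M) norm_unitFunctional_le c)
    change ‖l - _‖ < _ at hlc
    linarith
  · change ‖c‖ ≤ ‖l‖ at hc
    have := norm_le_norm_add_norm_sub y l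
    linarith

/-! ### Stability through trace symmetry, and commutation of limit operators -/

theorem isWeakStarContinuous_of_comp_mem (φ : Elem M →L[ℂ] Elem M)
    (h : ∀ l : Predual M, l.1 ∘L φ ∈ Predual M) : IsWeakStarContinuous φ := by
  refine continuous_iInf_rng.2 fun q => ?_
  rw [continuous_induced_rng]
  obtain ⟨k, hk, -⟩ := exists_hasSum_pairing M q
  have : (fun A : Elem M => ultraweakPairing q.1 q.2 (A : H →L[ℂ] H)) ∘ φ = k.1 ∘L φ :=
    funext fun A => (LinearMap.congr_fun hk (φ A)).symm
  rw [this]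
  exact h k

/-- The functionals `τ(X ·)` are norm-dense in the predual. -/
theorem mem_closure_range_traceMap (τ : FaithfulNormalTrace M) (l : Predual M) :
    l.1 ∈ closure (Set.range fun X => (traceMap τ X).1) := by
  by_contra hl
  let V : Submodule ℂ (StrongDual ℂ (Elem M)) :=
    LinearMap.range ((Predual M).subtype ∘ₗ traceMap τ)
  obtain ⟨f, u, hu, hfl⟩ := RCLike.geometric_hahn_banach_closed_point (𝕜 := ℂ)
    ((V.restrictScalars ℝ).convex.closure) isClosed_closure hl
  have hV : ∀ X, f (traceMap τ X).1 = 0 := fun X => by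
    by_contra h0
    -- A nonzero value could be rescaled inside the subspace to equal `u`, against the strict bound.
    have h1 := hu (((u / f (traceMap τ X).1 : ℂ)) • (traceMap τ X).1)
      (subset_closure (V.smul_mem _ ⟨X, rfl⟩))
    rw [map_smul, smul_eq_mul, div_mul_cancel₀ _ h0] at h1
    simp at h1
  have hu0 : 0 < u := by simpa using hu 0 (subset_closure V.zero_mem)
  obtain ⟨C, hC0, hC⟩ := f.bound
  obtain ⟨A, hA, -⟩ := exists_of_predual_dual M
    (f.toLinearMap ∘ₗ (Predual M).subtype) C hC0.le fun k => hC k.1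
  -- Testing on $\tau(A^*\,\cdot)$ gives $\tau(A^*A)=0$, and the trace is faithful.
  have hA0 : A = 0 := by
    have h1 : τ.toPredual.1 (star A * A) = 0 := (hA (traceMap τ (star A))).trans (hV _)
    have h2 : star A * A = 0 := τ.faithful _
      (ContinuousLinearMap.isPositive_adjoint_comp_self (A : H →L[ℂ] H)) h1
    exact CStarRing.star_mul_self_eq_zero_iff A |>.1 h2
  have h3 : f l.1 = 0 := by
    refine (hA l).symm.trans ?_
    rw [hA0, map_zero]
  rw [h3] at hfl
  simp at hfl
  linarith

/-- A bounded operator on `M` which is symmetric to another one for the bilinear form `τ(XY)` is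
stable, and the other operator is its dual. -/
theorem exists_isTauStable_of_trace_eq (τ : FaithfulNormalTrace M) (φ φ' : Elem M →L[ℂ] Elem M)
    (h : ∀ X Y, τ.toPredual.1 (φ' X * Y) = τ.toPredual.1 (X * φ Y)) :
    ∃ hφ : IsTauStable τ φ, tauDual τ φ hφ = φ' := by
  have hX : ∀ X, (traceMap τ X).1 ∘L φ = (traceMap τ (φ' X)).1 := fun X =>
    ContinuousLinearMap.ext fun Y => (h X Y).symm
  have hw : IsWeakStarContinuous φ := isWeakStarContinuous_of_comp_mem φ fun l => by
    have hc : Continuous fun k : StrongDual ℂ (Elem M) => k ∘L φ := by fun_prop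
    rw [← SetLike.mem_coe, ← (isClosed_predual M).closure_eq]
    refine map_mem_closure (f := fun k : StrongDual ℂ (Elem M) => k ∘L φ) hc (mem_closure_range_traceMap τ l) ?_
    rintro _ ⟨X, rfl⟩
    change (traceMap τ X).1 ∘L φ ∈ _
    rw [hX]
    exact (traceMap τ (φ' X)).2
  have hs : IsTauStable τ φ := by
    refine ⟨hw, ?_⟩
    rintro _ ⟨X, rfl⟩
    exact ⟨φ' X, Subtype.ext (hX X).symm⟩
  refine ⟨hs, ContinuousLinearMap.ext fun X => traceMap_injective τ ?_⟩
  refine (traceMap_tauDualLin τ φ hs X).trans (Subtype.ext (hX X))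

theorem exists_isTauStable_limitOperator (τ : FaithfulNormalTrace M) {p : Gauge}
    {Φ : ℕ+ → Elem M →L[ℂ] Elem M} (hst : ∀ n, IsTauStable τ (Φ n)) (hΦ : IsDominated Φ p)
    (hΦd : IsDominated (fun n => tauDual τ (Φ n) (hst n)) p) (L : StrongDual ℂ (ℕ+ →ᵇ ℂ)) :
    ∃ hE : IsTauStable τ (limitOperator hΦ L),
      tauDual τ (limitOperator hΦ L) hE = limitOperator hΦd L := by
  -- By the trace property both sides are values of $L$ on sequences that agree term by term.
  refine exists_isTauStable_of_trace_eq τ _ _ fun X Y => ?_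
  rw [τ.trace_comm, ← traceMap_apply, ← traceMap_apply, limitOperator_spec, limitOperator_spec]
  congr 1
  ext n
  change (traceMap τ Y).1 (tauDualLin τ (Φ n) (hst n) X) * _ = (traceMap τ X).1 (Φ n Y) * _
  rw [traceMap_apply, traceMap_apply, τ.trace_comm, trace_tauDualLin]

/-- A limit operator commutes with the weak-star continuous operators that commute with the
sequence. -/
theorem limitOperator_comp_comm {p : Gauge} {Φ : ℕ+ → Elem M →L[ℂ] Elem M}
    (hΦ : IsDominated Φ p) (L : StrongDual ℂ (ℕ+ →ᵇ ℂ)) {φ : Elem M →L[ℂ] Elem M}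
    (hφ : IsWeakStarContinuous φ) (hc : ∀ n, Φ n ∘L φ = φ ∘L Φ n) :
    limitOperator hΦ L ∘L φ = φ ∘L limitOperator hΦ L := by
  refine ContinuousLinearMap.ext fun X => ext_of_predual fun l => ?_
  change l.1 (limitOperator hΦ L (φ X)) = (preadjoint φ hφ l).1 (limitOperator hΦ L X)
  rw [limitOperator_spec, limitOperator_spec]
  congr 1
  ext n
  exact congrArg (fun T : Elem M →L[ℂ] Elem M => l.1 (T X) * ((p n : ℝ) : ℂ)⁻¹) (hc n)

/-- Two uses of `limitOperator_comp_comm`: each `Φ n` commutes with the second limit operator,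
which, being weak-star continuous, then commutes with the first. -/
theorem limitOperator_commute {p : Gauge} {Φ : ℕ+ → Elem M →L[ℂ] Elem M}
    (hΦ : IsDominated Φ p) (hw : ∀ n, IsWeakStarContinuous (Φ n))
    (hab : ∀ m n, Φ m ∘L Φ n = Φ n ∘L Φ m) {L₁ L₂ : StrongDual ℂ (ℕ+ →ᵇ ℂ)}
    (hE : IsWeakStarContinuous (limitOperator hΦ L₂)) :
    limitOperator hΦ L₁ ∘L limitOperator hΦ L₂ = limitOperator hΦ L₂ ∘L limitOperator hΦ L₁ :=
  limitOperator_comp_comm hΦ L₁ hE fun n =>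
    (limitOperator_comp_comm hΦ L₂ (hw n) fun m => hab m n).symm

theorem exists_isTauStable_pow (τ : FaithfulNormalTrace M) (ψ : Elem M →L[ℂ] Elem M)
    (hψ : IsTauStable τ ψ) (n : ℕ) :
    ∃ h : IsTauStable τ (ψ ^ n), tauDual τ (ψ ^ n) h = tauDual τ ψ hψ ^ n := by
  refine exists_isTauStable_of_trace_eq τ _ _ fun X Y => ?_
  induction n generalizing X with
  | zero => simp
  | succ n ih =>
    -- Transposition reverses products: the dual factor acting first on `X` matches the factor of
    -- `ψ` acting last on `Y`.
    rw [pow_succ, pow_succ']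
    change τ.toPredual.1 ((tauDual τ ψ hψ ^ n) (tauDual τ ψ hψ X) * Y) =
      τ.toPredual.1 (X * ψ ((ψ ^ n) Y))
    rw [ih]
    exact trace_tauDualLin τ ψ hψ X _

/-! ### Banach limits and almost convergence -/

/-- The average of `u` over the window `[k, k + n]`. -/
noncomputable def windowAverage (u : ℕ+ → ℂ) (k n : ℕ+) : ℂ :=
  (1 / (((n : ℕ) : ℂ) + 1)) * ∑ i ∈ Finset.Icc k (k + n), u i

theorem card_window (k n : ℕ+) : (Finset.Icc k (k + n)).card = (n : ℕ) + 1 := by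
  rw [PNat.card_Icc, PNat.add_coe]
  omega

theorem norm_windowFactor (n : ℕ+) : ‖(1 / (((n : ℕ) : ℂ) + 1))‖ = 1 / ((n : ℕ) + 1 : ℝ) := by
  rw [← Nat.cast_add_one, norm_div, norm_one, Complex.norm_natCast, Nat.cast_add_one]

theorem windowAverage_add (u v : ℕ+ → ℂ) (k n : ℕ+) :
    windowAverage (u + v) k n = windowAverage u k n + windowAverage v k n := by
  simp [windowAverage, Finset.sum_add_distrib, mul_add]

theorem windowAverage_smul (a : ℂ) (u : ℕ+ → ℂ) (k n : ℕ+) :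
    windowAverage (a • u) k n = a * windowAverage u k n := by
  simp only [windowAverage, Pi.smul_apply, smul_eq_mul, ← Finset.mul_sum]
  ring

theorem windowAverage_one (k n : ℕ+) : windowAverage 1 k n = 1 := by
  have : ((n : ℕ) : ℂ) + 1 ≠ 0 := Nat.cast_add_one_ne_zero _
  simp only [windowAverage, Pi.one_apply, Finset.sum_const, card_window, nsmul_eq_mul, mul_one]
  push_cast
  field_simp

theorem norm_windowAverage_le {u : ℕ+ → ℂ} {C : ℝ} (hu : ∀ n, ‖u n‖ ≤ C) (k n : ℕ+) :
    ‖windowAverage u k n‖ ≤ C := by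
  rw [windowAverage, norm_mul, norm_windowFactor, one_div, inv_mul_le_iff₀ (by positivity)]
  refine (norm_sum_le_of_le _ fun i _ => hu i).trans (le_of_eq ?_)
  rw [Finset.sum_const, card_window, nsmul_eq_mul]
  push_cast
  rfl

/-- The two windows differ only at their end points, so for bounded `u` the difference is $O(1/n)$
uniformly in `k`; this yields shift invariance of limits of averages. -/
theorem windowAverage_shift (u : ℕ+ →ᵇ ℂ) (k n : ℕ+) :
    windowAverage (shift u) k n - windowAverage u k n =
      (1 / (((n : ℕ) : ℂ) + 1)) * (u (k + n + 1) - u k) := by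
  rw [windowAverage, windowAverage, ← mul_sub]
  congr 1
  have h1 : ∑ i ∈ Finset.Icc k (k + n), shift u i = ∑ i ∈ Finset.Icc (k + 1) (k + n + 1), u i := by
    -- Truncated subtraction in `ℕ+` is harmless, since `i ≥ k + 1 > 1` there.
    refine Finset.sum_nbij' (fun i => i + 1) (fun i => i - 1) ?_ ?_ ?_ ?_ ?_
    · intro i hi
      simpa using hi
    · intro i hi
      rw [Finset.mem_Icc] at hi ⊢
      have h1 : 1 < i := lt_of_lt_of_le (PNat.lt_add_left 1 k) hi.1
      rw [← PNat.coe_le_coe, ← PNat.coe_le_coe, PNat.sub_coe, if_pos h1]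
      simp only [← PNat.coe_le_coe, PNat.add_coe, PNat.one_coe] at hi ⊢
      omega
    · intro i _
      simp
    · intro i hi
      rw [Finset.mem_Icc] at hi
      exact PNat.sub_add_of_lt (lt_of_lt_of_le (PNat.lt_add_left 1 k) hi.1)
    · intro i _
      rfl
  have h2 : ∑ i ∈ Finset.Icc k (k + n + 1), u i =
      ∑ i ∈ Finset.Icc k (k + n), u i + u (k + n + 1) := by
    have : Finset.Icc k (k + n + 1) = insert (k + n + 1) (Finset.Icc k (k + n)) := by
      ext i
      simp only [Finset.mem_Icc, Finset.mem_insert, ← PNat.coe_le_coe, ← PNat.coe_inj,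
        PNat.add_coe, PNat.one_coe]
      omega
    rw [this, Finset.sum_insert, add_comm]
    simp only [Finset.mem_Icc, ← PNat.coe_le_coe, PNat.add_coe, PNat.one_coe]
    omega
  have h3 : ∑ i ∈ Finset.Icc k (k + n + 1), u i =
      u k + ∑ i ∈ Finset.Icc (k + 1) (k + n + 1), u i := by
    have : Finset.Icc k (k + n + 1) = insert k (Finset.Icc (k + 1) (k + n + 1)) := by
      ext i
      simp only [Finset.mem_Icc, Finset.mem_insert, ← PNat.coe_le_coe, ← PNat.coe_inj,
        PNat.add_coe, PNat.one_coe]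
      omega
    rw [this, Finset.sum_insert]
    simp only [Finset.mem_Icc, ← PNat.coe_le_coe, PNat.add_coe, PNat.one_coe]
    omega
  rw [h1]
  linear_combination h2 - h3

/-- The bounded sequence `k ↦ windowAverage u k n`. -/
noncomputable def windowAverageSeq (u : ℕ+ →ᵇ ℂ) (n : ℕ+) : ℕ+ →ᵇ ℂ :=
  BoundedContinuousFunction.ofNormedAddCommGroupDiscrete (fun k => windowAverage u k n) ‖u‖
    fun k => norm_windowAverage_le u.norm_coe_le_norm k n

theorem iterate_shift_apply (u : ℕ+ →ᵇ ℂ) (j : ℕ) (k : ℕ+) :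
    (shift^[j] u) k = u ⟨k + j, by positivity⟩ := by
  induction j generalizing k with
  | zero => rfl
  | succ j ih =>
    rw [Function.iterate_succ_apply']
    refine (ih (k + 1)).trans ?_
    congr 1
    apply PNat.eq
    simp only [PNat.mk_coe, PNat.add_coe, PNat.one_coe]
    omega

/-- As an average of iterated shifts of `u`, this sequence has the same Banach limits as `u`. -/
theorem windowAverageSeq_eq (u : ℕ+ →ᵇ ℂ) (n : ℕ+) :
    windowAverageSeq u n =
      (1 / (((n : ℕ) : ℂ) + 1)) • ∑ j ∈ Finset.range ((n : ℕ) + 1), shift^[j] u := by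
  ext k
  rw [BoundedContinuousFunction.smul_apply, BoundedContinuousFunction.coe_sum, Finset.sum_apply,
    smul_eq_mul]
  change (1 / (((n : ℕ) : ℂ) + 1)) * _ = _
  congr 1
  refine Finset.sum_nbij' (fun i => (i : ℕ) - k) (fun j => ⟨k + j, by positivity⟩) ?_ ?_ ?_ ?_ ?_
  · intro i hi
    simp only [Finset.mem_Icc, ← PNat.coe_le_coe, PNat.add_coe, Finset.mem_range] at hi ⊢
    omega
  · intro j hj
    rw [Finset.mem_range] at hj
    refine Finset.mem_Icc.2 ⟨(PNat.coe_le_coe _ _).1 ?_, (PNat.coe_le_coe _ _).1 ?_⟩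
    · exact Nat.le_add_right _ _
    · rw [PNat.add_coe, PNat.mk_coe]
      omega
  · intro i hi
    simp only [Finset.mem_Icc, ← PNat.coe_le_coe] at hi
    apply PNat.eq
    simp only [PNat.mk_coe]
    omega
  · intro j _
    simp
  · intro i hi
    simp only [Finset.mem_Icc, ← PNat.coe_le_coe] at hi
    rw [iterate_shift_apply]
    congr 1
    apply PNat.eq
    simp only [PNat.mk_coe]
    omega

theorem bddAbove_windowAverage {u : ℕ+ → ℂ} {C : ℝ} (hu : ∀ n, ‖u n‖ ≤ C) (c : ℂ) (n : ℕ+) :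
    BddAbove (Set.range fun k => ‖windowAverage u k n - c‖) := by
  refine ⟨C + ‖c‖, ?_⟩
  rintro _ ⟨k, rfl⟩
  exact (norm_sub_le _ _).trans (add_le_add_left (norm_windowAverage_le hu k n) _)

theorem IsBanachLimit.map_windowAverageSeq {L : StrongDual ℂ (ℕ+ →ᵇ ℂ)} (hL : IsBanachLimit L)
    (u : ℕ+ →ᵇ ℂ) (n : ℕ+) : L (windowAverageSeq u n) = L u := by
  have h : ∀ j : ℕ, L (shift^[j] u) = L u := by
    intro j
    induction j with
    | zero => rfl
    | succ j ih => rw [Function.iterate_succ_apply', hL.map_shift, ih]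
  have : ((n : ℕ) : ℂ) + 1 ≠ 0 := Nat.cast_add_one_ne_zero _
  rw [windowAverageSeq_eq, map_smul, map_sum, Finset.sum_congr rfl fun j _ => h j]
  simp only [Finset.sum_const, Finset.card_range, nsmul_eq_mul, smul_eq_mul]
  push_cast
  field_simp

theorem IsBanachLimit.eq_of_almostConvergesTo {L : StrongDual ℂ (ℕ+ →ᵇ ℂ)}
    (hL : IsBanachLimit L) {u : ℕ+ →ᵇ ℂ} {c : ℂ} (hu : AlmostConvergesTo u c) : L u = c := by
  have h : ∀ n, ‖L u - c‖ ≤ ⨆ k, ‖windowAverage u k n - c‖ := fun n => by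
    -- Replacing `u` by its averages changes no Banach limit, and `‖L‖ = 1` then bounds the error by
    -- a supremum tending to zero.
    have h1 : L u - c = L (windowAverageSeq u n - c • 1) := by
      rw [map_sub, map_smul, hL.map_one, hL.map_windowAverageSeq, smul_eq_mul, mul_one]
    have h2 := L.le_opNorm (windowAverageSeq u n - c • 1)
    rw [hL.norm_eq, one_mul] at h2
    rw [h1]
    refine h2.trans ((BoundedContinuousFunction.norm_le_of_nonempty).2 fun k => ?_)
    have h3 := le_ciSup (bddAbove_windowAverage u.norm_coe_le_norm c n) k
    refine le_trans (le_of_eq ?_) h3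
    change ‖windowAverage u k n - c * 1‖ = _
    rw [mul_one]
  have h0 : ‖L u - c‖ ≤ 0 := ge_of_tendsto' hu.2 h
  exact sub_eq_zero.1 (norm_le_zero_iff.1 h0)

theorem tendsto_pnat_coe_atTop : Tendsto (fun n : ℕ+ => (n : ℕ)) atTop atTop :=
  tendsto_atTop_atTop.2 fun b => ⟨b.succPNat, fun _ hn =>
    (Nat.le_succ b).trans (PNat.coe_le_coe _ _ |>.2 hn)⟩

theorem tendsto_succPNat_atTop : Tendsto Nat.succPNat atTop atTop :=
  tendsto_atTop_atTop.2 fun b => ⟨b, fun n hn =>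
    (PNat.coe_le_coe _ _).1 (le_trans hn (Nat.le_succ n))⟩

/-- The averages over windows of growing length converge, along an ultrafilter, to a Banach
limit. -/
theorem exists_isBanachLimit_tendsto (k n : ℕ → ℕ+) (hn : Tendsto n atTop atTop) :
    ∃ L, IsBanachLimit L ∧ ∀ u : ℕ+ →ᵇ ℂ,
      Tendsto (fun j => windowAverage u (k j) (n j)) (hyperfilter ℕ) (𝓝 (L u)) := by
  have hex : ∀ u : ℕ+ →ᵇ ℂ, ∃ a : ℂ, ‖a‖ ≤ ‖u‖ ∧
      Tendsto (fun j => windowAverage u (k j) (n j)) (hyperfilter ℕ) (𝓝 a) := fun u => by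
    obtain ⟨a, ha, h⟩ := (isCompact_closedBall (0 : ℂ) ‖u‖).ultrafilter_le_nhds
      ((hyperfilter ℕ).map fun j => windowAverage u (k j) (n j)) (by
        rw [Ultrafilter.coe_map, le_principal_iff, mem_map]
        exact univ_mem' fun j => by
          simpa using norm_windowAverage_le u.norm_coe_le_norm (k j) (n j))
    exact ⟨a, by simpa using ha, h⟩
  choose ℓ hℓ hlim using hex
  let L : StrongDual ℂ (ℕ+ →ᵇ ℂ) := LinearMap.mkContinuous
    { toFun := ℓ
      map_add' := fun u v => by
        refine tendsto_nhds_unique (hlim (u + v)) (((hlim u).add (hlim v)).congr fun j => ?_)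
        exact (windowAverage_add u v _ _).symm
      map_smul' := fun a u => by
        refine tendsto_nhds_unique (hlim (a • u)) (((hlim u).const_mul a).congr fun j => ?_)
        exact (windowAverage_smul a u _ _).symm }
    1 fun u => by rw [one_mul]; exact hℓ u
  have hone : L 1 = 1 := by
    refine tendsto_nhds_unique (hlim 1) (tendsto_const_nhds.congr fun j => ?_)
    exact (windowAverage_one _ _).symm
  refine ⟨L, ⟨le_antisymm (LinearMap.mkContinuous_norm_le _ zero_le_one _) ?_, hone, ?_⟩, hlim⟩
  · have := L.le_opNorm 1
    rwa [hone, norm_one, norm_one, mul_one] at this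
  · intro u
    refine sub_eq_zero.1 (tendsto_nhds_unique ((hlim (shift u)).sub (hlim u)) ?_)
    -- The difference of averages tends to zero in the ordinary sense, hence along the ultrafilter.
    refine Tendsto.mono_left ?_ Nat.hyperfilter_le_atTop
    simp only [windowAverage_shift]
    refine squeeze_zero_norm (a := fun j => 1 / ((n j : ℕ) + 1 : ℝ) * (2 * ‖u‖)) (fun j => ?_) ?_
    · rw [norm_mul, norm_windowFactor]
      gcongr
      refine (norm_sub_le _ _).trans ?_
      linarith [u.norm_coe_le_norm (k j + n j + 1), u.norm_coe_le_norm (k j)]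
    · have h1 : Tendsto (fun j => ((n j : ℕ))) atTop atTop := tendsto_pnat_coe_atTop.comp hn
      simpa using (tendsto_one_div_add_atTop_nhds_zero_nat.comp h1).mul_const (2 * ‖u‖)

theorem exists_isBanachLimit : ∃ L, IsBanachLimit L := by
  obtain ⟨L, hL, -⟩ := exists_isBanachLimit_tendsto (fun _ => 1) Nat.succPNat tendsto_succPNat_atTop
  exact ⟨L, hL⟩

/-- Lorentz's theorem: a bounded sequence at which all Banach limits take the value `c` almost
converges to `c`. -/
theorem almostConvergesTo_of_forall_isBanachLimit (u : ℕ+ →ᵇ ℂ) (c : ℂ)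
    (h : ∀ L, IsBanachLimit L → L u = c) : AlmostConvergesTo u c := by
  refine ⟨⟨‖u‖, by rintro _ ⟨n, rfl⟩; exact u.norm_coe_le_norm n⟩, ?_⟩
  change Tendsto (fun n => ⨆ k, ‖windowAverage u k n - c‖) atTop (𝓝 0)
  rw [Metric.tendsto_atTop]
  by_contra! hcon
  obtain ⟨ε, hε, hcon⟩ := hcon
  -- The supremum over `k` need not be attained, so half of `ε` is given up. A Banach limit built
  -- from these windows would miss `c`.
  have hex : ∀ j : ℕ, ∃ k n : ℕ+, j.succPNat ≤ n ∧ ε / 2 ≤ ‖windowAverage u k n - c‖ := fun j => by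
    obtain ⟨n, hn, hd⟩ := hcon j.succPNat
    rw [Real.dist_eq, sub_zero, abs_of_nonneg (Real.iSup_nonneg fun _ => norm_nonneg _)] at hd
    obtain ⟨k, hk⟩ := exists_lt_of_lt_ciSup (lt_of_lt_of_le (half_lt_self hε) hd)
    exact ⟨k, n, hn, hk.le⟩
  choose k n hn hk using hex
  obtain ⟨L, hL, hlim⟩ := exists_isBanachLimit_tendsto k n
    (tendsto_atTop_mono hn tendsto_succPNat_atTop)
  have h1 := ((hlim u).sub_const c).norm
  rw [h L hL, sub_self, norm_zero] at h1
  linarith [ge_of_tendsto' h1 hk]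

/-- Window averages of $u(r-c)$ are dominated by $\|u\|$ times those of $|r-c|$; absolute values
inside the average are what allow a bounded factor. -/
theorem StronglyAlmostConvergesTo.mul_sub {r : ℕ+ → ℂ} {c : ℂ}
    (hr : StronglyAlmostConvergesTo r c) (u : ℕ+ →ᵇ ℂ) :
    AlmostConvergesTo (fun n => u n * (r n - c)) 0 := by
  obtain ⟨⟨C, hC⟩, hlim⟩ := hr
  have hC' : ∀ n, ‖((‖r n - c‖ : ℝ) : ℂ)‖ ≤ C := fun n => hC ⟨n, rfl⟩
  constructor
  · refine ⟨‖u‖ * C, ?_⟩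
    rintro _ ⟨n, rfl⟩
    have := hC' n
    rw [Complex.norm_real, norm_norm] at this
    change ‖u n * (r n - c)‖ ≤ _
    rw [norm_mul]
    gcongr
    exact u.norm_coe_le_norm n
  · change Tendsto (fun n => ⨆ k, ‖windowAverage (fun n => ((‖r n - c‖ : ℝ) : ℂ)) k n - 0‖)
      atTop (𝓝 0) at hlim
    change Tendsto (fun n => ⨆ k, ‖windowAverage (fun n => u n * (r n - c)) k n - 0‖) atTop (𝓝 0)
    have hlim' := hlim.const_mul ‖u‖
    rw [mul_zero] at hlim'
    refine squeeze_zero (fun n => Real.iSup_nonneg fun _ => norm_nonneg _) (fun n => ?_) hlim'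
    refine ciSup_le fun k => ?_
    refine le_trans ?_ (mul_le_mul_of_nonneg_left
      (le_ciSup (bddAbove_windowAverage hC' 0 n) k) (norm_nonneg u))
    rw [sub_zero, sub_zero, windowAverage, windowAverage, norm_mul, norm_mul, ← Complex.ofReal_sum,
      Complex.norm_real, Real.norm_of_nonneg (Finset.sum_nonneg fun _ _ => norm_nonneg _),
      mul_left_comm, Finset.mul_sum]
    gcongr
    refine norm_sum_le_of_le _ fun i _ => ?_
    rw [norm_mul]
    gcongr
    exact u.norm_coe_le_norm i

theorem evalSeq_coe (L : StrongDual ℂ (ℕ+ →ᵇ ℂ)) (v : ℕ+ →ᵇ ℂ) : evalSeq L v = L v := by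
  have h : ∃ C, ∀ n, ‖v n‖ ≤ C := ⟨‖v‖, v.norm_coe_le_norm⟩
  rw [evalSeq, dif_pos h]
  -- The bound chosen inside `evalSeq` does not affect the underlying function.
  rfl

/-! ### Limit operators of the powers of one map -/

section Powers

variable {p : Gauge} {ψ : Elem M →L[ℂ] Elem M}
  (hΦ : IsDominated (fun n : ℕ+ => ψ ^ (n : ℕ)) p) {L : StrongDual ℂ (ℕ+ →ᵇ ℂ)}

theorem apply_limitOperator_powers (hψ : IsWeakStarContinuous ψ) (hL : IsBanachLimit L)
    (X : Elem M) : ψ (limitOperator hΦ L X) = (p.rate : ℂ) • limitOperator hΦ L X := by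
  refine ext_of_predual fun l => ?_
  change (preadjoint ψ hψ l).1 (limitOperator hΦ L X) = _
  -- With $a_n=[l,\psi^n(X)]/p(n)$, the left sequence is $a_{n+1}p(n+1)/p(n)$. Shifting the right
  -- one to $c_pa_{n+1}$ leaves the difference $a_{n+1}(p(n+1)/p(n)-c_p)$.
  rw [map_smul, limitOperator_spec, limitOperator_spec,
    ← hL.map_shift (pairingSeq hΦ l X), ← map_smul,
    ← sub_eq_zero, ← map_sub]
  refine hL.eq_of_almostConvergesTo ?_
  convert p.ratio.mul_sub (shift (pairingSeq hΦ l X)) using 2 with n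
  have hp : ((p n : ℝ) : ℂ) ≠ 0 := Complex.ofReal_ne_zero.2 (p.pos n).ne'
  have hp' : ((p (n + 1) : ℝ) : ℂ) ≠ 0 := Complex.ofReal_ne_zero.2 (p.pos (n + 1)).ne'
  change l.1 (ψ ((ψ ^ (n : ℕ)) X)) * ((p n : ℝ) : ℂ)⁻¹ -
      (p.rate : ℂ) * (l.1 ((ψ ^ ((n + 1 : ℕ+) : ℕ)) X) * ((p (n + 1) : ℝ) : ℂ)⁻¹) =
    l.1 ((ψ ^ ((n + 1 : ℕ+) : ℕ)) X) * ((p (n + 1) : ℝ) : ℂ)⁻¹ *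
      (((p (n + 1) / p n : ℝ) : ℂ) - p.rate)
  rw [PNat.add_coe, PNat.one_coe, pow_succ']
  change _ - _ * (l.1 (ψ ((ψ ^ (n : ℕ)) X)) * _) = l.1 (ψ ((ψ ^ (n : ℕ)) X)) * _ * _
  push_cast
  field_simp

theorem pow_apply_limitOperator_powers (hψ : IsWeakStarContinuous ψ) (hL : IsBanachLimit L)
    (n : ℕ) (X : Elem M) :
    (ψ ^ n) (limitOperator hΦ L X) = ((p.rate : ℂ) ^ n) • limitOperator hΦ L X := by
  induction n with
  | zero => simp
  | succ n ih =>
    rw [pow_succ']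
    change ψ ((ψ ^ n) (limitOperator hΦ L X)) = _
    rw [ih, map_smul, apply_limitOperator_powers hΦ hψ hL, smul_smul, pow_succ]

theorem pairingSeq_limitOperator_powers (hψ : IsWeakStarContinuous ψ) (hL : IsBanachLimit L)
    (l : Predual M) (X : Elem M) (n : ℕ+) :
    pairingSeq hΦ l (limitOperator hΦ L X) n = l.1 (limitOperator hΦ L X) * p.quotient n := by
  change l.1 ((ψ ^ (n : ℕ)) (limitOperator hΦ L X)) * ((p n : ℝ) : ℂ)⁻¹ = _
  rw [pow_apply_limitOperator_powers hΦ hψ hL, map_smul, Gauge.quotient, smul_eq_mul]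
  push_cast
  ring

/-- The sequence $[l,E_L(X)]\,c_p^n/p(n)$ is bounded by domination, so an unbounded quotient forces
$[l,E_L(X)]=0$. -/
theorem limitOperator_powers_eq_zero (hψ : IsWeakStarContinuous ψ) (hL : IsBanachLimit L)
    (hq : ¬ BddAbove (Set.range fun n => ‖p.quotient n‖)) : limitOperator hΦ L = 0 := by
  refine ContinuousLinearMap.ext fun X => ext_of_predual fun l => ?_
  change l.1 (limitOperator hΦ L X) = l.1 0
  rw [map_zero]
  by_contra h0
  apply hq
  refine ⟨‖pairingSeq hΦ l (limitOperator hΦ L X)‖ / ‖l.1 (limitOperator hΦ L X)‖, ?_⟩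
  rintro _ ⟨n, rfl⟩
  have h1 := (pairingSeq hΦ l (limitOperator hΦ L X)).norm_coe_le_norm n
  rw [pairingSeq_limitOperator_powers hΦ hψ hL, norm_mul] at h1
  rw [le_div_iff₀ (norm_pos_iff.2 h0), mul_comm]
  exact h1

theorem limitOperator_powers_comp (hψ : IsWeakStarContinuous ψ) (hL : IsBanachLimit L)
    (K : StrongDual ℂ (ℕ+ →ᵇ ℂ)) :
    limitOperator hΦ K ∘L limitOperator hΦ L = gaugeLimit K p • limitOperator hΦ L := by
  by_cases hq : BddAbove (Set.range fun n => ‖p.quotient n‖)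
  · obtain ⟨C, hC⟩ := hq
    let v : ℕ+ →ᵇ ℂ := BoundedContinuousFunction.ofNormedAddCommGroupDiscrete p.quotient C
      fun n => hC ⟨n, rfl⟩
    have hv : gaugeLimit K p = K v := evalSeq_coe K v
    refine ContinuousLinearMap.ext fun X => ext_of_predual fun l => ?_
    change l.1 (limitOperator hΦ K (limitOperator hΦ L X)) =
      l.1 (gaugeLimit K p • limitOperator hΦ L X)
    have h1 : pairingSeq hΦ l (limitOperator hΦ L X) = l.1 (limitOperator hΦ L X) • v := by
      ext n
      exact pairingSeq_limitOperator_powers hΦ hψ hL l X n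
    rw [limitOperator_spec, h1, map_smul, map_smul, hv, smul_eq_mul, smul_eq_mul, mul_comm]
  · rw [limitOperator_powers_eq_zero hΦ hψ hL hq, ContinuousLinearMap.comp_zero]
    exact ContinuousLinearMap.ext fun X => (smul_zero (A := Elem M) (gaugeLimit K p)).symm

end Powers

theorem gaugeLimit_eq_of_almostConvergesTo {p : Gauge} {d : ℂ} (hd : AlmostConvergesTo p.quotient d)
    {L : StrongDual ℂ (ℕ+ →ᵇ ℂ)} (hL : IsBanachLimit L) : gaugeLimit L p = d := by
  obtain ⟨C, hC⟩ := hd.1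
  let v : ℕ+ →ᵇ ℂ := BoundedContinuousFunction.ofNormedAddCommGroupDiscrete p.quotient C
    fun n => hC ⟨n, rfl⟩
  exact (evalSeq_coe L v).trans (hL.eq_of_almostConvergesTo (u := v) hd)

/-- If all Banach limits define the same limit operator, then the normalized sequence weakly
almost converges to it. -/
theorem weaklyAlmostConvergesTo_of_forall_limitOperator_eq {p : Gauge}
    {Φ : ℕ+ → Elem M →L[ℂ] Elem M} (hΦ : IsDominated Φ p) (φ : Elem M →L[ℂ] Elem M)
    (h : ∀ L, IsBanachLimit L → limitOperator hΦ L = φ) :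
    WeaklyAlmostConvergesTo (fun n => ((p n : ℝ) : ℂ)⁻¹ • Φ n) φ := by
  intro l X
  have := almostConvergesTo_of_forall_isBanachLimit (pairingSeq hΦ l X - l.1 (φ X) • 1) 0
    fun L hL => by
      rw [map_sub, map_smul, hL.map_one, ← limitOperator_spec, h L hL, smul_eq_mul, mul_one,
        sub_self]
  convert this using 2 with n
  change l.1 (((p n : ℝ) : ℂ)⁻¹ • Φ n X - φ X) =
    l.1 (Φ n X) * ((p n : ℝ) : ℂ)⁻¹ - l.1 (φ X) * 1
  rw [map_sub, map_smul, smul_eq_mul, mul_comm, mul_one]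

theorem exists_isTauStable_limitOperator_powers (τ : FaithfulNormalTrace M) {p : Gauge}
    {ψ : Elem M →L[ℂ] Elem M} (hψ : IsTauStable τ ψ)
    (hΦ : IsDominated (fun n : ℕ+ => ψ ^ (n : ℕ)) p)
    (hΦd : IsDominated (fun n : ℕ+ => tauDual τ ψ hψ ^ (n : ℕ)) p)
    (L : StrongDual ℂ (ℕ+ →ᵇ ℂ)) : IsTauStable τ (limitOperator hΦ L) := by
  choose hst heq using fun n : ℕ+ => exists_isTauStable_pow τ ψ hψ n
  exact (exists_isTauStable_limitOperator τ hst hΦ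
    (fun n => (congrArg norm (heq n)).trans_le (hΦd n)) L).1

end FiniteVN

theorem theorem2p4 {H : Type*} [NormedAddCommGroup H] [InnerProductSpace ℂ H] [CompleteSpace H]
    [TopologicalSpace.SeparableSpace H] (M : VonNeumannAlgebra H) (τ : FaithfulNormalTrace M)
    (p : Gauge) :
    (∀ (Φ : ℕ+ → Elem M →L[ℂ] Elem M) (hst : ∀ n, IsTauStable τ (Φ n))
        (hΦ : IsDominated Φ p)
        (hΦd : IsDominated (fun n => tauDual τ (Φ n) (hst n)) p),
      (∀ L, IsBanachLimit L →
        ∃ hE : IsTauStable τ (limitOperator hΦ L),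
          tauDual τ (limitOperator hΦ L) hE = limitOperator hΦd L) ∧
      ((∀ m n, Φ m ∘L Φ n = Φ n ∘L Φ m) →
        ∀ L₁ L₂, IsBanachLimit L₁ → IsBanachLimit L₂ →
          limitOperator hΦ L₁ ∘L limitOperator hΦ L₂ =
            limitOperator hΦ L₂ ∘L limitOperator hΦ L₁)) ∧
    (∀ (ψ : Elem M →L[ℂ] Elem M) (hψ : IsTauStable τ ψ)
        (hΦ : IsDominated (fun n : ℕ+ => ψ ^ (n : ℕ)) p)
        (_hΦd : IsDominated (fun n : ℕ+ => tauDual τ ψ hψ ^ (n : ℕ)) p),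
      (∀ L₁ L₂, IsBanachLimit L₁ → IsBanachLimit L₂ →
        limitOperator hΦ L₂ ∘L limitOperator hΦ L₁ =
            limitOperator hΦ L₁ ∘L limitOperator hΦ L₂ ∧
          limitOperator hΦ L₁ ∘L limitOperator hΦ L₂ =
            gaugeLimit L₁ p • limitOperator hΦ L₂ ∧
          gaugeLimit L₁ p • limitOperator hΦ L₂ = gaugeLimit L₂ p • limitOperator hΦ L₁) ∧
      -- the convention in the definition of `gaugeLimit` is harmless
      (¬ BddAbove (Set.range fun n => ‖p.quotient n‖) →
        ∀ L, IsBanachLimit L → limitOperator hΦ L = 0) ∧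
      (∀ d : ℂ, d ≠ 0 → AlmostConvergesTo p.quotient d →
        ∃ φ : Elem M →L[ℂ] Elem M, IsTauStable τ φ ∧
          WeaklyAlmostConvergesTo (fun n : ℕ+ => ((p n : ℝ) : ℂ)⁻¹ • ψ ^ (n : ℕ)) φ)) := by
  refine ⟨fun Φ hst hΦ hΦd => ⟨fun L _ => exists_isTauStable_limitOperator τ hst hΦ hΦd L,
    fun hab L₁ L₂ _ _ => limitOperator_commute hΦ (fun n => (hst n).1) hab
      (exists_isTauStable_limitOperator τ hst hΦ hΦd L₂).1.1⟩, fun ψ hψ hΦ hΦd => ?_⟩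
  have hE := exists_isTauStable_limitOperator_powers τ hψ hΦ hΦd
  have hcomp := fun {L} (hL : IsBanachLimit L) => limitOperator_powers_comp hΦ hψ.1 hL
  have hcomm : ∀ L₁ L₂, limitOperator hΦ L₂ ∘L limitOperator hΦ L₁ =
      limitOperator hΦ L₁ ∘L limitOperator hΦ L₂ := fun L₁ L₂ =>
    limitOperator_commute hΦ
      (fun n => (exists_isTauStable_pow τ ψ hψ n).1.1)
      (fun m n => ((Commute.refl ψ).pow_pow m n).eq) (hE L₁).1
  have hgauge : ∀ L₁ L₂, IsBanachLimit L₁ → IsBanachLimit L₂ →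
      gaugeLimit L₁ p • limitOperator hΦ L₂ = gaugeLimit L₂ p • limitOperator hΦ L₁ :=
    fun L₁ L₂ h₁ h₂ => by rw [← hcomp h₁, ← hcomp h₂, hcomm]
  refine ⟨fun L₁ L₂ h₁ h₂ => ⟨hcomm L₁ L₂, hcomp h₂ L₁, hgauge L₁ L₂ h₁ h₂⟩,
    fun hq L hL => limitOperator_powers_eq_zero hΦ hψ.1 hL hq, fun d hd hconv => ?_⟩
  obtain ⟨L₀, hL₀⟩ := exists_isBanachLimit
  refine ⟨limitOperator hΦ L₀, hE L₀,
    weaklyAlmostConvergesTo_of_forall_limitOperator_eq hΦ _ fun L hL => ?_⟩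
  have h := hgauge L₀ L hL₀ hL
  rw [gaugeLimit_eq_of_almostConvergesTo hconv hL₀,
    gaugeLimit_eq_of_almostConvergesTo hconv hL] at h
  exact ContinuousLinearMap.ext fun X =>
    smul_right_injective (Elem M) hd (DFunLike.congr_fun h X)
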